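/- Let $n \ge 0$ and $m \ge 1$ be integers, let $X = (x_1,\dots,x_n)$, and let $G_{n,m} = S_n \wr \mathbb{Z}_m$ be the group of complex $n\times n$ matrices with exactly one nonzero entry in each row and each column, every nonzero entry being an $m$-th root of unity. For $g\in G_{n,m}$ let $w(g)$ be the product of its nonzero entries, and let $\sigma_g$ be the permutation of $\{1,\dots,n\}$ such that $g_{i,\sigma_g(i)}\neq 0$ for all $i$. For indices $i_1<\dots<i_l$ and integers $k_1,\dots,k_l>0$, write $\{j_1<\dots<j_l\}=\{\sigma_g(i_1),\dots,\sigma_g(i_l)\}$ and put $$g\bullet \bigl(x_{i_1}^{k_1}\cdots x_{i_l}^{k_l}\bigr) = w(g)^{c}\, x_{j_1}^{k_1}\cdots x_{j_l}^{k_l},$$ where $c=0$ if $m$ divides all the $k_r$ and $c=1$ otherwise; extend $g\bullet$ linearly to $\mathbb{C}[X]$. Let $$QInv_{n,m}=\{P\in\mathbb{C}[X] : g\bullet P=P \text{ for all } g\in G_{n,m}\},$$ let $QInv_{n,m}^+$ be the set of elements of $QInv_{n,m}$ without constant term, and let $\langle QInv_{n,m}^+\rangle$ be the ideal of $\mathbb{C}[X]$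 that it generates. For $\eta\in\mathbb{N}^n$ let $\pi(\eta)$ be the lattice path $$(0,0)\to(\eta_1,0)\to(\eta_1,1)\to(\eta_1+\eta_2,1)\to\cdots\to(\eta_1+\cdots+\eta_n,n-1)\to(\eta_1+\cdots+\eta_n,n).$$ Call $\eta$ a Dyck vector if $\pi(\eta)$ stays weakly above the diagonal, i.e. all its points $(x,y)$ satisfy $x\le y$. **Theorem.** The set of monomials $$\mathcal{B}_{n,m}=\{X^{m\eta+\alpha} : \eta\in\mathbb{N}^n \text{ a Dyck vector},\ \alpha\in\mathbb{N}^n,\ 0\le\alpha_i<m \text{ for all } i\}$$ is a basis of the complex vector space $\mathbb{C}[X]/\langle QInv_{n,m}^+\rangle$; that is, the classes of the elements of $\mathcal{B}_{n,m}$ are pairwise distinct and form a basis. -/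

import Mathlib

namespace QuasiInv

open MvPolynomial

noncomputable section

/-- The generalized symmetric group `S_n ≀ ℤ_m`, as the set of complex `n × n` matrices having
exactly one nonzero entry in each row and in each column, all nonzero entries being `m`-th roots
of unity. -/
def genSymGroup (n m : ℕ) : Set (Matrix (Fin n) (Fin n) ℂ) :=
  {g | (∀ i, ∃! j, g i j ≠ 0) ∧ (∀ j, ∃! i, g i j ≠ 0) ∧ ∀ i j, g i j ≠ 0 → g i j ^ m = 1}

open Classical in
/-- The weight `w(g)`: the product of the nonzero entries of `g`. -/
def weight {n : ℕ} (g : Matrix (Fin n) (Fin n) ℂ) : ℂ :=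
  ∏ i, ∏ j, if g i j = 0 then 1 else g i j

open Classical in
/-- The set of (indices of) variables occurring in `A · ᵗ|g|`: replacing `X` by `X · ᵗ|g|` sends
`x_i` to `∑ j, |g i j| x_j`, which for `g` in the group is the single variable `x_j` with
`g i j ≠ 0`. -/
def moveVars {n : ℕ} (g : Matrix (Fin n) (Fin n) ℂ) (A : Finset (Fin n)) : Finset (Fin n) :=
  Finset.univ.filter fun j => ∃ i ∈ A, g i j ≠ 0

/-- The composition `K = c(ν)`: the nonzero entries of `ν`, in order. Thus `X^ν = A^K` where `A`
is the set of variables in the support of `ν`. -/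
def compositionOf {n : ℕ} (ν : Fin n →₀ ℕ) : List ℕ :=
  (ν.support.sort (· ≤ ·)).map ν

open Classical in
/-- The exponent `c(K)`: `0` if all parts of `K` are divisible by `m`, and `1` otherwise. -/
def weightExponent (m : ℕ) (K : List ℕ) : ℕ :=
  if ∀ k ∈ K, m ∣ k then 0 else 1

/-- The monomial `(B)_<^K`: the variables of `B`, in increasing order, raised to the successive
powers in `K`. -/
def orderedMonomial {n : ℕ} (B : Finset (Fin n)) (K : List ℕ) : MvPolynomial (Fin n) ℂ :=
  (List.zipWith (fun j k => (X j : MvPolynomial (Fin n) ℂ) ^ k) (B.sort (· ≤ ·)) K).prod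

/-- The quasi-symmetrizing action of a matrix `g` on polynomials: the linear map with
`g • A^K = w(g)^{c(K)} (A · ᵗ|g|)_<^K` on monomials. -/
def quasiAct {n : ℕ} (m : ℕ) (g : Matrix (Fin n) (Fin n) ℂ) :
    MvPolynomial (Fin n) ℂ →ₗ[ℂ] MvPolynomial (Fin n) ℂ :=
  (basisMonomials (Fin n) ℂ).constr ℂ fun ν =>
    weight g ^ weightExponent m (compositionOf ν) •
      orderedMonomial (moveVars g ν.support) (compositionOf ν)

/-- The quasi-invariant polynomials. -/
def QInv (n m : ℕ) : Set (MvPolynomial (Fin n) ℂ) :=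
  {P | ∀ g ∈ genSymGroup n m, quasiAct m g P = P}

/-- The quasi-invariant polynomials without constant term. -/
def QInvPlus (n m : ℕ) : Set (MvPolynomial (Fin n) ℂ) :=
  {P | P ∈ QInv n m ∧ constantCoeff P = 0}

/-- The partial sum `ν_1 + ⋯ + ν_k`. -/
def partialSum {n : ℕ} (ν : Fin n →₀ ℕ) (k : ℕ) : ℕ :=
  ∑ i ∈ Finset.univ.filter (fun i : Fin n => (i : ℕ) < k), ν i

/-- The lattice points on the path
`(0,0) → (ν_1,0) → (ν_1,1) → (ν_1+ν_2,1) → ⋯ → (ν_1+⋯+ν_n,n-1) → (ν_1+⋯+ν_n,n)`: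
those of the horizontal runs at heights `0, …, n-1`, and the end point. -/
def latticePath {n : ℕ} (ν : Fin n →₀ ℕ) : Set (ℕ × ℕ) :=
  {p | (p.2 < n ∧ partialSum ν p.2 ≤ p.1 ∧ p.1 ≤ partialSum ν (p.2 + 1)) ∨
    p = (partialSum ν n, n)}

/-- `ν` is a Dyck vector: its path stays (weakly) above the diagonal `y = x`. -/
def IsDyck {n : ℕ} (ν : Fin n →₀ ℕ) : Prop :=
  ∀ p ∈ latticePath ν, p.1 ≤ p.2

/-- The set of monomials `X^{m η + α}` with `η` a Dyck vector and `0 ≤ α_i < m`. -/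
def dyckMonomials (n m : ℕ) : Set (MvPolynomial (Fin n) ℂ) :=
  {P | ∃ η α : Fin n →₀ ℕ, IsDyck η ∧ (∀ i, α i < m) ∧ P = monomial (m • η + α) 1}

end

end QuasiInv

namespace QuasiInv

open MvPolynomial

/-! Quasi-invariants are exactly the quasi-symmetric polynomials in the powers `x_i ^ m`. Since
`ℂ[X]` splits into residue classes of exponents modulo `m`, with multiplication by `expand m q`
preserving each class, everything reduces to `m = 1`: Dyck monomials form a basis modulo
`quasiIdeal` (`exists_expand_eq_of_mem_QInv`, `residuePart_mul_expand`).

For spanning, each exponent `ν` gets a polynomial `groebnerPoly ν`, a combination of fundamental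
quasi-symmetric polynomials, with lex-leading monomial `X^ν` (`leading_groebnerPoly`). If `ν` is not
Dyck, it lies in the ideal (`groebner_mem`), so `X^ν` reduces to lex-smaller monomials.

For independence, no Gröbner theory is needed. Setting `x_i` or `x_{i+1}` to zero gives the same
result on quasi-symmetric polynomials; on the whole ideal the two results differ by `x_i` times an
element of the ideal in one variable fewer (`exists_dropVar_sub_eq`). For a Dyck-supported
polynomial that element is again Dyck-supported, hence zero by induction on `n`. The coefficients
then allow nonzero exponents to slide left through zeros, whereas a Dyck vector starts with zero;
only the constant term can survive (`eq_zero_of_mem_of_isDyck`). -/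

/-- One step of the recursion defining the fundamental quasi-symmetric functions: adding a new
first variable `x`. Compositions are stored as the list of their parts, each diminished by one. -/
def fundStep {R : Type*} [CommRing R] (x : R) (φ : List ℕ → R) : List ℕ → R
  | [] => φ []
  | 0 :: β => x * φ β + φ (0 :: β)
  | (a + 1) :: β => x * fundStep x φ (a :: β) + φ ((a + 1) :: β)

/-- The fundamental quasi-symmetric function of a composition (parts diminished by one), evaluated
at a list of ring elements. -/
def fund {R : Type*} [CommRing R] : List R → List ℕ → R
  | [], [] => 1
  | [], _ :: _ => 0
  | x :: l, α => fundStep x (fund l) α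

/-- The inverse of `fundStep`. -/
def unstep {R : Type*} [CommRing R] (x : R) (φ : List ℕ → R) : List ℕ → R
  | [] => φ []
  | 0 :: β => φ (0 :: β) - x * unstep x φ β
  | (a + 1) :: β => φ ((a + 1) :: β) - x * φ (a :: β)

/-- The Gröbner basis elements attached to an exponent vector, as a functional of a family indexed
by compositions. -/
def groebner {R : Type*} [CommRing R] : List R → List ℕ → (List ℕ → R) → R
  | x :: l, 0 :: ε, φ => groebner l ε (unstep x φ)
  | _ :: l, (c + 1) :: ε, φ => groebner l ε fun β => φ (c :: β)
  | _, _, φ => φ []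

/-! ### Recursions for fundamental quasi-symmetric functions and Gröbner elements. -/

section Recursions

variable {R S : Type*} [CommRing R] [CommRing S]

theorem unstep_fundStep (x : R) (φ : List ℕ → R) : unstep x (fundStep x φ) = φ := by
  funext α
  induction α with
  | nil => simp [unstep, fundStep]
  | cons a β ih => cases a <;> simp [unstep, fundStep, ih]

theorem unstep_lin (x c : R) (φ ψ : List ℕ → R) :
    unstep x (fun α => c * φ α + ψ α) = fun α => c * unstep x φ α + unstep x ψ α := by
  funext α
  induction α with
  | nil => simp [unstep]
  | cons a β ih =>
    cases a
    · simp only [unstep, ih]; ring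
    · simp only [unstep]; ring

theorem groebner_lin (l : List R) (ε : List ℕ) (c : R) (φ ψ : List ℕ → R) :
    groebner l ε (fun α => c * φ α + ψ α) = c * groebner l ε φ + groebner l ε ψ := by
  induction l generalizing ε φ ψ with
  | nil => simp [groebner]
  | cons x l ih =>
    match ε with
    | [] => simp [groebner]
    | 0 :: ε => simp only [groebner, unstep_lin, ih]
    | (a + 1) :: ε => simp only [groebner, ih]

theorem groebner_zero_cons (x : R) (l : List R) (ε : List ℕ) :
    groebner (x :: l) (0 :: ε) (fund (x :: l)) = groebner l ε (fund l) := by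
  have : fund (x :: l) = fundStep x (fund l) := by funext α; simp [fund]
  rw [groebner, this, unstep_fundStep]

/-- The recursion of `fund` in its first part passes through `groebner` by linearity. The last
summand is free of `x`, which is what identifies the leading monomial. The case `c = 0` is separate
because a zero exponent goes through `unstep`. -/
theorem groebner_succ_cons (x : R) (l : List R) (c : ℕ) (ε : List ℕ) :
    groebner (x :: l) ((c + 1) :: ε) (fund (x :: l)) =
      x * groebner (x :: l) (c :: ε) (fund (x :: l)) +
        groebner l ε fun β => fund l (c :: β) := by
  cases c with
  | zero => rw [groebner_zero_cons, ← groebner_lin]; simp only [groebner, fund, fundStep]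
  | succ c => simp only [groebner, fund, fundStep, ← groebner_lin]

theorem map_fundStep {F : Type*} [FunLike F R S] [RingHomClass F R S]
    (f : F) (x : R) (φ : List ℕ → R) (α : List ℕ) :
    f (fundStep x φ α) = fundStep (f x) (fun β => f (φ β)) α := by
  match α with
  | [] => simp [fundStep]
  | a :: β =>
    induction a with
    | zero => simp [fundStep]
    | succ a ih => simp [fundStep, ih]

theorem map_fund {F : Type*} [FunLike F R S] [RingHomClass F R S]
    (f : F) (l : List R) (α : List ℕ) :
    f (fund l α) = fund (l.map f) α := by
  induction l generalizing α with
  | nil => cases α <;> simp [fund]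
  | cons x l ih => simp [fund, map_fundStep, ih]

theorem map_unstep {F : Type*} [FunLike F R S] [RingHomClass F R S]
    (f : F) (x : R) (φ : List ℕ → R) (α : List ℕ) :
    f (unstep x φ α) = unstep (f x) (fun β => f (φ β)) α := by
  induction α with
  | nil => simp [unstep]
  | cons a β ih => cases a <;> simp [unstep, ih]

theorem map_groebner {F : Type*} [FunLike F R S] [RingHomClass F R S]
    (f : F) (l : List R) (ε : List ℕ) (φ : List ℕ → R) :
    f (groebner l ε φ) = groebner (l.map f) ε fun α => f (φ α) := by
  induction l generalizing ε φ with
  | nil => simp [groebner]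
  | cons x l ih =>
    match ε with
    | [] => simp [groebner]
    | 0 :: ε => simp [groebner, ih, map_unstep]
    | (a + 1) :: ε => simp [groebner, ih]

theorem fundStep_zero (φ : List ℕ → R) : fundStep 0 φ = φ := by
  funext α
  match α with
  | [] => simp [fundStep]
  | 0 :: β => simp [fundStep]
  | (a + 1) :: β => simp [fundStep]

/-- A zero entry contributes `fundStep 0`, the identity, so it can be deleted wherever it stands;
quasi-symmetry of `fundPoly` rests on this. -/
theorem fund_ofFn_succAbove {n : ℕ} (x : Fin (n + 1) → R) (j : Fin (n + 1)) (hj : x j = 0)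
    (α : List ℕ) : fund (List.ofFn x) α = fund (List.ofFn fun i => x (j.succAbove i)) α := by
  induction n generalizing α with
  | zero =>
    obtain rfl : j = 0 := Fin.fin_one_eq_zero j
    simp [fund, hj, fundStep_zero]
  | succ n ih =>
    refine Fin.cases (fun hj => ?_) (fun k hk => ?_) j hj
    · rw [List.ofFn_succ, fund, hj, fundStep_zero]
      simp
    · rw [List.ofFn_succ, fund, funext (ih (fun i => x i.succ) k hk)]
      conv_rhs => rw [List.ofFn_succ, fund]
      simp

theorem fund_replicate_zero (k a : ℕ) (α : List ℕ) :
    fund (List.replicate k (0 : R)) (a :: α) = 0 := by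
  induction k with
  | zero => simp [fund]
  | succ k ih => rw [List.replicate_succ, fund, fundStep_zero, ih]

/-- `Overflows d ε`: some partial sum `ε_1 + ⋯ + ε_k` exceeds `d + k - 1`. -/
def Overflows : ℕ → List ℕ → Prop
  | _, [] => False
  | d, c :: ε => d < c ∨ Overflows (d + 1 - c) ε

theorem Overflows.anti {d d' : ℕ} {ε : List ℕ} (h : Overflows d ε) (hd : d' ≤ d) :
    Overflows d' ε := by
  induction ε generalizing d d' with
  | nil => exact h
  | cons c ε ih =>
    rcases h with h | h
    · exact Or.inl (by omega)
    · exact Or.inr (ih h (by omega))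

/-- Undoing a variable costs one unit of the threshold: lowering the first part by one lowers later
partial sums by one, while removing a part equal to 1 leaves the threshold `d + 1` unchanged. The
unit is regained in `groebner_mem`, where a zero exponent raises the threshold by one. -/
theorem unstep_mem (J : Ideal R) (x : R) (φ : List ℕ → R) (d : ℕ)
    (hφ : ∀ α : List ℕ, Overflows d (α.map (· + 1)) → φ α ∈ J) (α : List ℕ)
    (hα : Overflows (d + 1) (α.map (· + 1))) : unstep x φ α ∈ J := by
  induction α with
  | nil => exact hα.elim
  | cons a β ih =>
    have h0 : φ (a :: β) ∈ J := hφ _ (hα.anti (by omega))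
    cases a with
    | zero =>
      rw [unstep]
      refine J.sub_mem h0 (J.mul_mem_left _ (ih ?_))
      rcases hα with h | h <;> dsimp only at h
      · omega
      · simpa using h
    | succ a =>
      rw [unstep]
      refine J.sub_mem h0 (J.mul_mem_left _ (hφ _ ?_))
      rcases hα with h | h <;> dsimp only at h
      · exact Or.inl (by dsimp only; omega)
      · exact Or.inr (h.anti (by dsimp only; omega))

theorem unstep_mem_of_forall (J : Ideal R) (x : R) (φ : List ℕ → R) (hφ : ∀ α, φ α ∈ J)
    (α : List ℕ) : unstep x φ α ∈ J := by
  induction α with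
  | nil => exact hφ _
  | cons a β ih =>
    cases a <;> rw [unstep]
    · exact J.sub_mem (hφ _) (J.mul_mem_left _ ih)
    · exact J.sub_mem (hφ _) (J.mul_mem_left _ (hφ _))

theorem groebner_mem_of_forall (J : Ideal R) (l : List R) (ε : List ℕ) (φ : List ℕ → R)
    (hφ : ∀ α, φ α ∈ J) : groebner l ε φ ∈ J := by
  induction l generalizing ε φ with
  | nil => simpa [groebner] using hφ _
  | cons x l ih =>
    match ε with
    | [] => simpa [groebner] using hφ _
    | 0 :: ε => exact ih _ _ (unstep_mem_of_forall J x φ hφ)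
    | (a + 1) :: ε => exact ih _ _ fun β => hφ _

theorem groebner_mem (J : Ideal R) (l : List R) (ε : List ℕ) (hl : l.length = ε.length)
    (φ : List ℕ → R) (d : ℕ) (hφ : ∀ α : List ℕ, Overflows d (α.map (· + 1)) → φ α ∈ J)
    (hε : Overflows d ε) : groebner l ε φ ∈ J := by
  induction l generalizing ε φ d with
  | nil =>
    cases ε with
    | nil => exact hε.elim
    | cons => simp at hl
  | cons x l ih =>
    match ε with
    | [] => exact hε.elim
    | 0 :: ε =>
      refine ih ε (by simpa using hl) _ (d + 1) (unstep_mem J x φ d hφ) ?_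
      rcases hε with h | h
      · omega
      · simpa using h
    | (a + 1) :: ε =>
      rw [groebner]
      rcases hε with h | h
      -- The part `a + 1` overflows by itself, so the whole family lies in `J` whatever follows.
      · exact groebner_mem_of_forall J _ _ _ fun β => hφ _ (Or.inl h)
      · exact ih ε (by simpa using hl) _ _ (fun β hβ => hφ _ (Or.inr hβ)) h

end Recursions

/-! ### Compositions, insertion of a zero exponent, Dyck vectors -/

theorem length_compositionOf {n : ℕ} (ν : Fin n →₀ ℕ) :
    (compositionOf ν).length = ν.support.card := by
  simp [compositionOf]

theorem eq_of_compositionOf_eq {n : ℕ} {ν ν' : Fin n →₀ ℕ} (hs : ν.support = ν'.support)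
    (hc : compositionOf ν = compositionOf ν') : ν = ν' := by
  unfold compositionOf at hc
  rw [hs, List.map_inj_left] at hc
  ext i
  by_cases hi : i ∈ ν'.support
  · exact hc i (by simpa using hi)
  · rw [Finsupp.notMem_support_iff.1 hi, Finsupp.notMem_support_iff.1 (hs ▸ hi)]

theorem compositionOf_mapDomain_succAbove {n : ℕ} (j : Fin (n + 1)) (μ : Fin n →₀ ℕ) :
    compositionOf (μ.mapDomain j.succAbove) = compositionOf μ := by
  have hinj : Function.Injective j.succAbove := Fin.succAbove_right_injective
  have hs : (μ.mapDomain j.succAbove).support = μ.support.map (Fin.succAboveEmb j) := by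
    rw [Finsupp.mapDomain_support_of_injective hinj]
    ext; simp
  unfold compositionOf
  rw [hs, ← Finset.map_sort (r := (· ≤ ·))]
  · rw [List.map_map]
    exact List.map_congr_left fun i _ => by simp [Finsupp.mapDomain_apply hinj]
  · intro a _ b _
    simp

theorem exists_mapDomain_succAbove {n : ℕ} {ν : Fin (n + 1) →₀ ℕ} {j : Fin (n + 1)}
    (hj : ν j = 0) : ∃ μ : Fin n →₀ ℕ, ν = μ.mapDomain j.succAbove := by
  have hinj : Function.Injective j.succAbove := Fin.succAbove_right_injective
  refine ⟨ν.comapDomain j.succAbove hinj.injOn, (Finsupp.mapDomain_comapDomain _ hinj _ ?_).symm⟩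
  intro i hi
  rw [Fin.range_succAbove]
  rintro rfl
  simp [hj] at hi

/-- On each horizontal run the right end is the tightest point, and the end of the last run also
controls the final point of the path. -/
theorem isDyck_iff {n : ℕ} {ν : Fin n →₀ ℕ} :
    IsDyck ν ↔ ∀ k < n, partialSum ν (k + 1) ≤ k := by
  constructor
  · intro h k hk
    refine h (partialSum ν (k + 1), k) (Or.inl ⟨hk, ?_, le_rfl⟩)
    change partialSum ν k ≤ partialSum ν (k + 1)
    refine Finset.sum_le_sum_of_subset fun i => ?_
    simp only [Finset.mem_filter, Finset.mem_univ, true_and]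
    omega
  · rintro h ⟨x, y⟩ (⟨hy, -, hx⟩ | hp)
    · exact hx.trans (h y hy)
    · rw [hp]
      cases n with
      | zero => simp [partialSum]
      | succ n => exact (h n (by omega)).trans (by simp)

theorem partialSum_eq {n : ℕ} (ν : Fin n →₀ ℕ) (k : ℕ) :
    partialSum ν k = ∑ i : Fin n, if (i : ℕ) < k then ν i else 0 := by
  rw [partialSum, Finset.sum_filter]

theorem overflows_ofFn {n : ℕ} (ν : Fin n → ℕ) (d k : ℕ) (hk : k < n)
    (h : k + d < ∑ i : Fin n, if (i : ℕ) < k + 1 then ν i else 0) :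
    Overflows d (List.ofFn ν) := by
  induction n generalizing d k with
  | zero => omega
  | succ n ih =>
    rw [List.ofFn_succ]
    rw [Fin.sum_univ_succ] at h
    by_cases hd : d < ν 0
    · exact Or.inl hd
    cases k with
    | zero => simp at h; omega
    | succ k =>
      refine Or.inr (ih _ _ k (by omega) ?_)
      simp only [Fin.val_zero, Nat.zero_lt_succ, if_true, Fin.val_succ, Nat.add_lt_add_iff_right]
        at h
      omega

theorem overflows_of_not_isDyck {n : ℕ} {ν : Fin n →₀ ℕ} (h : ¬ IsDyck ν) :
    Overflows 0 (List.ofFn ν) := by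
  rw [isDyck_iff] at h
  push Not at h
  obtain ⟨k, hk, h⟩ := h
  exact overflows_ofFn ν 0 k hk (by rwa [partialSum_eq] at h)

theorem IsDyck.apply_zero {n : ℕ} {ν : Fin (n + 1) →₀ ℕ} (h : IsDyck ν) : ν 0 = 0 := by
  have := isDyck_iff.1 h 0 (by omega)
  rw [partialSum_eq, Fin.sum_univ_succ] at this
  simpa using this

theorem partialSum_mapDomain_succAbove {n : ℕ} (μ : Fin n →₀ ℕ) (j : Fin (n + 1)) (k : ℕ) :
    partialSum (μ.mapDomain j.succAbove) k =
      ∑ t : Fin n, if (j.succAbove t : ℕ) < k then μ t else 0 := by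
  rw [partialSum_eq, Fin.sum_univ_succAbove _ j, Finsupp.mapDomain_of_notMem_range _ _ (by simp)]
  simp [Finsupp.mapDomain_apply (Fin.succAbove_right_injective (p := j))]

/-- Inserting a zero delays each entry by at most one place, which loosens the bound by one; for
partial sums that include position `i`, the extra unit in `ν` compensates. Before position `i ≤ j`
nothing is shifted and `μ` agrees with `ν`. -/
theorem IsDyck.of_mapDomain_succAbove {n : ℕ} {μ ν : Fin n →₀ ℕ} {i : Fin n} {j : Fin (n + 1)}
    (hij : (i : ℕ) ≤ j) (hν : ν = μ + Finsupp.single i 1)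
    (h : IsDyck (ν.mapDomain j.succAbove)) : IsDyck μ := by
  rw [isDyck_iff] at h ⊢
  simp only [partialSum_mapDomain_succAbove] at h
  intro k hk
  by_cases hik : (i : ℕ) ≤ k
  · have h1 := h (k + 1) (by omega)
    have h2 : ∑ t : Fin n, (if (t : ℕ) < k + 1 then ν t else 0) ≤
        ∑ t : Fin n, if (j.succAbove t : ℕ) < k + 1 + 1 then ν t else 0 := by
      refine Finset.sum_le_sum fun t _ => ?_
      have : (j.succAbove t : ℕ) ≤ t + 1 := by
        rw [Fin.succAbove]; split_ifs <;> simp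
      split_ifs <;> omega
    have h3 : ∑ t : Fin n, (if (t : ℕ) < k + 1 then ν t else 0) =
        partialSum μ (k + 1) + 1 := by
      rw [partialSum_eq]
      have : ∀ t : Fin n, (if (t : ℕ) < k + 1 then ν t else 0) =
          (if (t : ℕ) < k + 1 then μ t else 0) + if t = i then 1 else 0 := by
        intro t
        rcases eq_or_ne t i with rfl | ht
        · simp [hν, Nat.lt_succ_of_le hik]
        · simp [hν, ht]
      rw [Finset.sum_congr rfl fun t _ => this t, Finset.sum_add_distrib]
      simp
    omega
  · have h1 := h k (by omega)
    refine le_trans ?_ h1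
    rw [partialSum_eq]
    refine Finset.sum_le_sum fun t _ => ?_
    by_cases ht : (t : ℕ) < k + 1
    · have : (j.succAbove t : ℕ) = t := by
        rw [Fin.succAbove_of_castSucc_lt _ _ (by rw [Fin.lt_def]; simp; omega)]; simp
      rw [if_pos ht, this, if_pos ht, hν]
      simp
    · simp [ht]

/-! ### Quasi-symmetric polynomials -/

/-- A polynomial is quasi-symmetric if its coefficients depend only on the compositions of the
exponents. -/
def IsQuasiSymm {n : ℕ} (f : MvPolynomial (Fin n) ℂ) : Prop :=
  ∀ μ ν : Fin n →₀ ℕ, compositionOf μ = compositionOf ν → coeff μ f = coeff ν f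

/-- The ideal generated by the quasi-symmetric polynomials without constant term. -/
noncomputable def quasiIdeal (n : ℕ) : Ideal (MvPolynomial (Fin n) ℂ) :=
  Ideal.span {f | IsQuasiSymm f ∧ constantCoeff f = 0}

/-- Setting the variable `x_j` to zero and renumbering the other ones. -/
noncomputable def dropVar {n : ℕ} (j : Fin (n + 1)) :
    MvPolynomial (Fin (n + 1)) ℂ →ₐ[ℂ] MvPolynomial (Fin n) ℂ :=
  killCompl (f := j.succAbove) Fin.succAbove_right_injective

theorem coeff_dropVar {n : ℕ} (j : Fin (n + 1)) (f : MvPolynomial (Fin (n + 1)) ℂ)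
    (μ : Fin n →₀ ℕ) : coeff μ (dropVar j f) = coeff (μ.mapDomain j.succAbove) f :=
  coeff_killCompl _

theorem dropVar_X_self {n : ℕ} (j : Fin (n + 1)) : dropVar j (X j) = 0 := by
  simp [dropVar, killCompl]

theorem dropVar_X_succAbove {n : ℕ} (j : Fin (n + 1)) (i : Fin n) :
    dropVar j (X (j.succAbove i)) = X i := by
  rw [dropVar, ← rename_X, killCompl_rename_app]

theorem constantCoeff_dropVar {n : ℕ} (j : Fin (n + 1)) (f : MvPolynomial (Fin (n + 1)) ℂ) :
    constantCoeff (dropVar j f) = constantCoeff f := by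
  rw [constantCoeff_eq, constantCoeff_eq, coeff_dropVar, Finsupp.mapDomain_zero]

theorem IsQuasiSymm.dropVar {n : ℕ} {f : MvPolynomial (Fin (n + 1)) ℂ} (hf : IsQuasiSymm f)
    (j : Fin (n + 1)) : IsQuasiSymm (dropVar j f) := by
  intro ν ν' h
  rw [coeff_dropVar, coeff_dropVar]
  exact hf _ _ (by simpa only [compositionOf_mapDomain_succAbove])

theorem IsQuasiSymm.dropVar_eq {n : ℕ} {f : MvPolynomial (Fin (n + 1)) ℂ} (hf : IsQuasiSymm f)
    (i j : Fin (n + 1)) : QuasiInv.dropVar i f = QuasiInv.dropVar j f := by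
  ext μ
  rw [coeff_dropVar, coeff_dropVar]
  exact hf _ _ (by simp only [compositionOf_mapDomain_succAbove])

/-- The fundamental quasi-symmetric polynomial in `n` variables. -/
noncomputable def fundPoly (n : ℕ) (α : List ℕ) : MvPolynomial (Fin n) ℂ :=
  fund (List.ofFn X) α

theorem dropVar_fundPoly {n : ℕ} (j : Fin (n + 1)) (α : List ℕ) :
    dropVar j (fundPoly (n + 1) α) = fundPoly n α := by
  rw [fundPoly, map_fund, List.map_ofFn,
    fund_ofFn_succAbove (dropVar j ∘ X) j (dropVar_X_self j)]
  simp only [Function.comp_apply, dropVar_X_succAbove]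
  rfl

/-- An exponent with a zero entry reduces to one variable fewer through `dropVar`. An exponent with
full support is determined by its composition. -/
theorem isQuasiSymm_fundPoly (n : ℕ) (α : List ℕ) : IsQuasiSymm (fundPoly n α) := by
  induction n with
  | zero => intro ν ν' _; rw [Subsingleton.elim ν ν']
  | succ n ih =>
    intro ν ν' h
    by_cases hν : ∃ i, ν i = 0
    · have hν' : ∃ i, ν' i = 0 := by
        by_contra hν'
        push Not at hν'
        have h2 := congrArg List.length h
        rw [length_compositionOf, length_compositionOf,
          show ν'.support = Finset.univ by ext; simp [hν'], Finset.card_univ,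
          Finset.card_eq_iff_eq_univ] at h2
        obtain ⟨i, hi⟩ := hν
        have := Finset.mem_univ i
        rw [← h2] at this
        simp [hi] at this
      obtain ⟨i, hi⟩ := hν
      obtain ⟨j, hj⟩ := hν'
      obtain ⟨μ, rfl⟩ := exists_mapDomain_succAbove hi
      obtain ⟨μ', rfl⟩ := exists_mapDomain_succAbove hj
      rw [← coeff_dropVar, ← coeff_dropVar, dropVar_fundPoly, dropVar_fundPoly]
      exact ih _ _ (by simpa only [compositionOf_mapDomain_succAbove] using h)
    · push Not at hν
      have hs : ν.support = Finset.univ := by ext; simp [hν]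
      have h2 := congrArg List.length h
      rw [length_compositionOf, length_compositionOf, hs, eq_comm,
        Finset.card_univ, Finset.card_eq_iff_eq_univ] at h2
      rw [eq_of_compositionOf_eq (hs.trans h2.symm) h]

theorem constantCoeff_fundPoly (n a : ℕ) (α : List ℕ) :
    constantCoeff (fundPoly n (a :: α)) = 0 := by
  have h := map_fund (constantCoeff (σ := Fin n) (R := ℂ)) (List.ofFn X) (a :: α)
  rw [List.map_ofFn, show (constantCoeff ∘ X : Fin n → ℂ) = fun _ => 0 by funext; simp,
    List.ofFn_const, fund_replicate_zero] at h
  exact h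

theorem fundPoly_mem (n : ℕ) (α : List ℕ) (h : Overflows 0 (α.map (· + 1))) :
    fundPoly n α ∈ quasiIdeal n := by
  cases α with
  | nil => exact h.elim
  | cons a α => exact Ideal.subset_span ⟨isQuasiSymm_fundPoly _ _, constantCoeff_fundPoly _ _ _⟩

/-! ### Spanning -/

/-- The Gröbner basis element with leading monomial `X^ν`. -/
noncomputable def groebnerPoly {n : ℕ} (ν : Fin n → ℕ) : MvPolynomial (Fin n) ℂ :=
  groebner (List.ofFn X) (List.ofFn ν) (fund (List.ofFn X))

theorem groebnerPoly_mem {n : ℕ} {ν : Fin n →₀ ℕ} (h : ¬ IsDyck ν) :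
    groebnerPoly ν ∈ quasiIdeal n :=
  groebner_mem _ _ _ (by simp) _ 0 (fundPoly_mem n) (overflows_of_not_isDyck h)

theorem coeff_cons_rename_succ {n : ℕ} (a : ℕ) (μ : Fin n →₀ ℕ) (g : MvPolynomial (Fin n) ℂ) :
    coeff (Finsupp.cons a μ) (rename Fin.succ g) = if a = 0 then coeff μ g else 0 := by
  split_ifs with ha
  · rw [← coeff_rename_mapDomain Fin.succ (Fin.succ_injective n)]
    congr 1
    ext i
    refine Fin.cases ?_ (fun i => ?_) i
    · rw [Finsupp.mapDomain_of_notMem_range _ _ (by simp), Finsupp.cons_zero, ha]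
    · rw [Finsupp.mapDomain_apply (Fin.succ_injective n), Finsupp.cons_succ]
  · refine coeff_rename_eq_zero _ _ _ fun u hu => absurd ?_ ha
    have := DFunLike.congr_fun hu 0
    rwa [Finsupp.mapDomain_of_notMem_range _ _ (by simp), Finsupp.cons_zero, eq_comm] at this

theorem coeff_cons_X_zero_mul {n : ℕ} (a : ℕ) (μ : Fin n →₀ ℕ)
    (p : MvPolynomial (Fin (n + 1)) ℂ) :
    coeff (Finsupp.cons a μ) (X 0 * p) =
      if a = 0 then 0 else coeff (Finsupp.cons (a - 1) μ) p := by
  rw [coeff_X_mul']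
  by_cases ha : a = 0
  · simp [ha]
  · rw [if_pos (by simpa using ha), if_neg ha]
    congr 1
    ext i
    refine Fin.cases ?_ (fun i => ?_) i <;> simp

theorem ofFn_X_succ (n : ℕ) :
    List.ofFn (X : Fin (n + 1) → MvPolynomial (Fin (n + 1)) ℂ) =
      X 0 :: (List.ofFn (X : Fin n → MvPolynomial (Fin n) ℂ)).map
        (rename Fin.succ : MvPolynomial (Fin n) ℂ →ₐ[ℂ] MvPolynomial (Fin (n + 1)) ℂ) := by
  rw [List.ofFn_succ, List.map_ofFn]
  congr 2
  funext i
  simp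

theorem ofFn_cons {n : ℕ} (a : ℕ) (μ : Fin n →₀ ℕ) :
    List.ofFn (Finsupp.cons a μ) = a :: List.ofFn μ := by
  rw [List.ofFn_succ]
  simp

theorem rename_groebner_fund {n : ℕ} (l ε : List ℕ) :
    (rename Fin.succ : MvPolynomial (Fin n) ℂ →ₐ[ℂ] MvPolynomial (Fin (n + 1)) ℂ)
        (groebner (List.ofFn X) ε fun β => fund (List.ofFn X) (l ++ β)) =
      groebner ((List.ofFn (X : Fin n → MvPolynomial (Fin n) ℂ)).map (rename Fin.succ)) ε
        fun β => fund ((List.ofFn (X : Fin n → MvPolynomial (Fin n) ℂ)).map (rename Fin.succ))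
          (l ++ β) := by
  rw [map_groebner]
  simp only [map_fund]

theorem groebnerPoly_cons_zero {n : ℕ} (ν : Fin n →₀ ℕ) :
    groebnerPoly (Finsupp.cons 0 ν) = rename Fin.succ (groebnerPoly ν) := by
  rw [groebnerPoly, ofFn_cons, ofFn_X_succ, groebner_zero_cons]
  exact (rename_groebner_fund [] _).symm

theorem exists_groebnerPoly_cons_succ {n : ℕ} (c : ℕ) (ν : Fin n →₀ ℕ) :
    ∃ h, groebnerPoly (Finsupp.cons (c + 1) ν) =
      X 0 * groebnerPoly (Finsupp.cons c ν) + rename Fin.succ h := by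
  refine ⟨groebner (List.ofFn X) (List.ofFn ν) fun β => fund (List.ofFn X) (c :: β), ?_⟩
  rw [groebnerPoly, groebnerPoly, ofFn_cons, ofFn_cons, ofFn_X_succ, groebner_succ_cons]
  exact congrArg _ (rename_groebner_fund [c] _).symm

theorem toLex_cons_le {n : ℕ} {a b : ℕ} {μ ν : Fin n →₀ ℕ}
    (h : a < b ∨ a = b ∧ toLex μ ≤ toLex ν) :
    toLex (Finsupp.cons a μ) ≤ toLex (Finsupp.cons b ν) := by
  rcases h with h | ⟨rfl, h⟩
  · refine le_of_lt (Finsupp.lex_def.2 ⟨0, fun j hj => absurd hj (by simp), by simpa⟩)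
  · rcases h.eq_or_lt with h | h
    · rw [toLex_inj.1 h]
    · obtain ⟨i, hi, hi'⟩ := Finsupp.lex_def.1 h
      refine le_of_lt (Finsupp.lex_def.2 ⟨i.succ, fun j => ?_, by simpa using hi'⟩)
      refine Fin.cases (fun _ => by simp) (fun j hj => ?_) j
      simpa using hi j (by simpa using hj)

theorem leading_groebnerPoly {n : ℕ} (ν : Fin n →₀ ℕ) :
    coeff ν (groebnerPoly ν) = 1 ∧
      ∀ μ, coeff μ (groebnerPoly ν) ≠ 0 → toLex μ ≤ toLex ν := by
  induction n with
  | zero =>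
    refine ⟨?_, fun μ _ => by rw [Subsingleton.elim μ ν]⟩
    rw [Subsingleton.elim ν 0]
    simp [groebnerPoly, groebner, fund]
  | succ n ih =>
    rw [← Finsupp.cons_tail ν]
    generalize ν 0 = c
    generalize ν.tail = ν
    obtain ⟨h1, h2⟩ := ih ν
    -- Terms free of `X 0` are lex-below any exponent with positive first entry, so the extra
    -- summand of the recursion never affects the leading term.
    have hlt : ∀ g : MvPolynomial (Fin n) ℂ, ∀ c' > 0, ∀ μ : Fin (n + 1) →₀ ℕ,
        coeff μ (rename Fin.succ g) ≠ 0 →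
        toLex μ ≤ toLex (Finsupp.cons c' ν) := by
      intro g c' hc' μ hμ
      rw [← Finsupp.cons_tail μ, coeff_cons_rename_succ] at hμ
      rw [← Finsupp.cons_tail μ]
      refine toLex_cons_le (Or.inl ?_)
      split_ifs at hμ with h0
      · omega
      · exact absurd rfl hμ
    induction c with
    | zero =>
      rw [groebnerPoly_cons_zero]
      refine ⟨by simpa [coeff_cons_rename_succ] using h1, fun μ hμ => ?_⟩
      rw [← Finsupp.cons_tail μ, coeff_cons_rename_succ] at hμ
      rw [← Finsupp.cons_tail μ]
      split_ifs at hμ with h0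
      · exact toLex_cons_le (Or.inr ⟨h0, h2 _ hμ⟩)
      · exact absurd rfl hμ
    | succ c ihc =>
      obtain ⟨h, hh⟩ := exists_groebnerPoly_cons_succ c ν
      rw [hh]
      constructor
      · rw [coeff_add, coeff_cons_X_zero_mul, coeff_cons_rename_succ]
        simpa using ihc.1
      · intro μ hμ
        by_cases hr : coeff μ (rename Fin.succ h) = 0
        · rw [coeff_add, hr, add_zero, ← Finsupp.cons_tail μ, coeff_cons_X_zero_mul] at hμ
          split_ifs at hμ with h0
          · exact absurd rfl hμ
          have h3 := ihc.2 _ hμ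
          rw [← Finsupp.cons_tail μ]
          refine toLex_cons_le ?_
          rcases h3.eq_or_lt with h3 | h3
          · have h4 := toLex_inj.1 h3
            have h5 := DFunLike.congr_fun h4 0
            have h6 := congrArg Finsupp.tail h4
            simp only [Finsupp.cons_zero, Finsupp.tail_cons] at h5 h6
            exact Or.inr ⟨by omega, by rw [h6]⟩
          · obtain ⟨i, hi, hi'⟩ := Finsupp.lex_def.1 h3
            revert hi hi'
            refine Fin.cases (fun _ hi' => ?_) (fun i hi hi' => ?_) i
            · exact Or.inl (by simp at hi'; omega)
            · refine Or.inr ⟨?_, le_of_lt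
                (Finsupp.lex_def.2 ⟨i, fun j hj => ?_, by simpa using hi'⟩)⟩
              · have := hi 0 (Fin.succ_pos i)
                simp at this
                omega
              · simpa using hi j.succ (by simpa using hj)
        · exact hlt h _ (by omega) μ hr

/-- The linear span of the monomials whose exponents are Dyck vectors. -/
noncomputable def dyckSpan (n : ℕ) : Submodule ℂ (MvPolynomial (Fin n) ℂ) :=
  Submodule.span ℂ {P | ∃ η : Fin n →₀ ℕ, IsDyck η ∧ P = monomial η 1}

theorem monomial_mem_sup {n : ℕ} (ν : Fin n →₀ ℕ) :
    monomial ν (1 : ℂ) ∈ dyckSpan n ⊔ (quasiIdeal n).restrictScalars ℂ := by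
  have hwf : WellFounded fun a b : Fin n →₀ ℕ => toLex a < toLex b :=
    InvImage.wf toLex (wellFounded_lt (α := Lex (Fin n →₀ ℕ)))
  induction ν using hwf.induction with
  | _ ν ih =>
  by_cases hν : IsDyck ν
  · exact Submodule.mem_sup_left (Submodule.subset_span ⟨ν, hν, rfl⟩)
  have hG : groebnerPoly ν ∈ dyckSpan n ⊔ (quasiIdeal n).restrictScalars ℂ :=
    Submodule.mem_sup_right (groebnerPoly_mem hν)
  obtain ⟨h1, h2⟩ := leading_groebnerPoly ν
  have hr : groebnerPoly ν - monomial ν 1 ∈ dyckSpan n ⊔ (quasiIdeal n).restrictScalars ℂ := by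
    rw [MvPolynomial.as_sum (groebnerPoly ν - monomial ν 1)]
    refine Submodule.sum_mem _ fun μ hμ => ?_
    have hne : μ ≠ ν := by
      rintro rfl
      simp [h1] at hμ
    rw [mem_support_iff, coeff_sub, coeff_monomial, if_neg hne.symm, sub_zero] at hμ
    rw [← mul_one (coeff μ _), ← smul_eq_mul, ← smul_monomial]
    exact Submodule.smul_mem _ _ (ih μ ((h2 μ hμ).lt_of_ne fun h => hne (toLex_inj.1 h)))
  simpa using Submodule.sub_mem _ hG hr

/-! ### Independence -/

theorem constantCoeff_of_mem {n : ℕ} {f : MvPolynomial (Fin n) ℂ} (hf : f ∈ quasiIdeal n) :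
    constantCoeff f = 0 := by
  have : quasiIdeal n ≤ RingHom.ker (constantCoeff (σ := Fin n) (R := ℂ)) :=
    Ideal.span_le.2 fun q hq => hq.2
  exact this hf

theorem dropVar_mem {n : ℕ} {f : MvPolynomial (Fin (n + 1)) ℂ} (hf : f ∈ quasiIdeal (n + 1))
    (j : Fin (n + 1)) : dropVar j f ∈ quasiIdeal n := by
  have : quasiIdeal (n + 1) ≤ (quasiIdeal n).comap (dropVar j) :=
    Ideal.span_le.2 fun q hq =>
      Ideal.subset_span ⟨hq.1.dropVar j, (constantCoeff_dropVar j q).trans hq.2⟩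
  exact this hf

/-- If `μ i = 0`, inserting a zero just before or just after position `i` gives the same exponent,
so the terms free of `X i` cancel. -/
theorem X_dvd_dropVar_sub {n : ℕ} (i : Fin n) (p : MvPolynomial (Fin (n + 1)) ℂ) :
    (X i : MvPolynomial (Fin n) ℂ) ∣ dropVar i.succ p - dropVar i.castSucc p := by
  rw [X_dvd_iff_modMonomial_eq_zero]
  ext μ
  by_cases hμ : Finsupp.single i 1 ≤ μ
  · rw [coeff_modMonomial_of_le _ hμ, coeff_zero]
  · rw [coeff_modMonomial_of_not_le _ hμ, coeff_sub, coeff_dropVar, coeff_dropVar, coeff_zero,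
      sub_eq_zero]
    congr 1
    refine Finsupp.mapDomain_congr fun t ht => ?_
    have hti : t ≠ i := by
      rintro rfl
      rw [Finsupp.single_le_iff] at hμ
      simp at ht
      omega
    rcases lt_or_gt_of_ne hti with h | h
    · rw [Fin.succAbove_of_castSucc_lt _ _ (by rw [Fin.lt_def] at *; simp; omega),
        Fin.succAbove_of_castSucc_lt _ _ (by rw [Fin.lt_def] at *; simp; omega)]
    · rw [Fin.succAbove_of_le_castSucc _ _ (by rw [Fin.le_def, Fin.lt_def] at *; simp; omega),
        Fin.succAbove_of_le_castSucc _ _ (by rw [Fin.le_def, Fin.lt_def] at *; simp; omega)]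

/-- The difference vanishes on generators and obeys a twisted Leibniz rule; `X_dvd_dropVar_sub`
supplies the factor `X i` coming from the multiplier. -/
theorem exists_dropVar_sub_eq {n : ℕ} {f : MvPolynomial (Fin (n + 1)) ℂ}
    (hf : f ∈ quasiIdeal (n + 1)) (i : Fin n) :
    ∃ g ∈ quasiIdeal n, dropVar i.succ f - dropVar i.castSucc f = X i * g := by
  induction hf using Submodule.span_induction with
  | mem q hq => exact ⟨0, zero_mem _, by rw [hq.1.dropVar_eq i.succ i.castSucc]; simp⟩
  | zero => exact ⟨0, zero_mem _, by simp⟩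
  | add a b _ _ ha hb =>
    obtain ⟨g, hg, hg'⟩ := ha
    obtain ⟨h, hh, hh'⟩ := hb
    refine ⟨g + h, add_mem hg hh, ?_⟩
    rw [map_add, map_add, mul_add, ← hg', ← hh']
    ring
  | smul p a ha' ha =>
    obtain ⟨g, hg, hg'⟩ := ha
    obtain ⟨h, hh⟩ := X_dvd_dropVar_sub i p
    refine ⟨h * dropVar i.succ a + dropVar i.castSucc p * g,
      add_mem (Ideal.mul_mem_left _ _ (dropVar_mem ha' _)) (Ideal.mul_mem_left _ _ hg), ?_⟩
    rw [smul_eq_mul, map_mul, map_mul]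
    linear_combination dropVar i.succ a * hh + dropVar i.castSucc p * hg'

theorem eq_zero_of_mem_of_isDyck {n : ℕ} {f : MvPolynomial (Fin n) ℂ} (hf : f ∈ quasiIdeal n)
    (hd : ∀ ν, coeff ν f ≠ 0 → IsDyck ν) : f = 0 := by
  induction n with
  | zero =>
    ext ν
    rw [Subsingleton.elim ν 0]
    exact constantCoeff_of_mem hf
  | succ n ih =>
    have hdrop : ∀ i : Fin n, dropVar i.succ f = dropVar i.castSucc f := by
      intro i
      obtain ⟨g, hg, hg'⟩ := exists_dropVar_sub_eq hf i
      rw [← sub_eq_zero, hg', ih hg ?_, mul_zero]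
      intro μ hμ
      -- A term of `g` at `μ` forces one of the two zero-insertions of `μ + single i 1` into the
      -- support of `f`, so `μ` is Dyck.
      rw [← coeff_X_mul μ i, ← hg', coeff_sub, coeff_dropVar, coeff_dropVar] at hμ
      by_cases h1 : coeff ((Finsupp.single i 1 + μ).mapDomain i.succ.succAbove) f = 0
      · rw [h1, zero_sub, neg_ne_zero] at hμ
        exact (hd _ hμ).of_mapDomain_succAbove (i := i) (by simp) (add_comm _ _)
      · exact (hd _ h1).of_mapDomain_succAbove (i := i) (by simp) (add_comm _ _)
    have key : ∀ (j : ℕ) (hj : j < n + 1) (ν : Fin (n + 1) →₀ ℕ), ν ⟨j, hj⟩ ≠ 0 →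
        coeff ν f = 0 := by
      intro j
      induction j with
      | zero =>
        intro hj ν hν
        by_contra h
        exact hν (hd ν h).apply_zero
      | succ j ihj =>
        intro hj ν hν
        let i : Fin n := ⟨j, by omega⟩
        -- If the left neighbour is zero, `hdrop` swaps that zero with the nonzero entry without
        -- changing the coefficient; otherwise the neighbour itself serves.
        by_cases h0 : ν i.castSucc = 0
        · obtain ⟨μ, rfl⟩ := exists_mapDomain_succAbove h0
          rw [← coeff_dropVar, ← hdrop, coeff_dropVar]
          refine ihj (by omega) _ ?_
          have e1 : (⟨j + 1, hj⟩ : Fin (n + 1)) = i.castSucc.succAbove i :=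
            (Fin.succAbove_castSucc_self i).symm
          have e2 : (⟨j, by omega⟩ : Fin (n + 1)) = i.succ.succAbove i :=
            (Fin.succAbove_succ_self i).symm
          rw [e1, Finsupp.mapDomain_apply Fin.succAbove_right_injective] at hν
          rwa [e2, Finsupp.mapDomain_apply Fin.succAbove_right_injective]
        · exact ihj (by omega) ν h0
    ext ν
    by_cases hν : ν = 0
    · rw [hν]
      exact constantCoeff_of_mem hf
    · obtain ⟨j, hj⟩ := DFunLike.ne_iff.1 hν
      exact key j j.2 ν hj

/-! ### Quasi-invariants -/

theorem exists_monomial_zipWith {n : ℕ} (L : List (Fin n)) (K : List ℕ) (hL : L.Nodup)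
    (hK : L.length = K.length) :
    ∃ ν : Fin n →₀ ℕ,
      (List.zipWith (fun j k => (X j : MvPolynomial (Fin n) ℂ) ^ k) L K).prod = monomial ν 1 ∧
        L.map ν = K ∧ ∀ i ∉ L, ν i = 0 := by
  induction L generalizing K with
  | nil =>
    obtain rfl : K = [] := by simpa [eq_comm] using hK
    exact ⟨0, by simp, by simp, by simp⟩
  | cons j L ih =>
    cases K with
    | nil => simp at hK
    | cons k K =>
      obtain ⟨hj, hL⟩ := List.nodup_cons.1 hL
      obtain ⟨ν, h1, h2, h3⟩ := ih K hL (by simpa using hK)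
      refine ⟨Finsupp.single j k + ν, ?_, ?_, ?_⟩
      · rw [List.zipWith_cons_cons, List.prod_cons, h1, X_pow_eq_monomial, monomial_mul, one_mul]
      · rw [List.map_cons]
        congr 1
        · simp [h3 j hj]
        · rw [← h2]
          refine List.map_congr_left fun i hi => ?_
          have : j ≠ i := by rintro rfl; exact hj hi
          simp [this]
      · intro i hi
        rw [List.mem_cons, not_or] at hi
        simp [Ne.symm hi.1, h3 i hi.2]

theorem exists_orderedMonomial_eq {n : ℕ} (B : Finset (Fin n)) (K : List ℕ)
    (hB : B.card = K.length) (hK : ∀ k ∈ K, k ≠ 0) :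
    ∃ ν : Fin n →₀ ℕ, ν.support = B ∧ compositionOf ν = K ∧
      orderedMonomial B K = monomial ν 1 := by
  obtain ⟨ν, h1, h2, h3⟩ := exists_monomial_zipWith (B.sort (· ≤ ·)) K (B.sort_nodup _) (by simpa)
  have hs : ν.support = B := by
    ext i
    rw [Finsupp.mem_support_iff]
    refine ⟨fun hi => ?_, fun hi => hK _ ?_⟩
    · by_contra hB
      exact hi (h3 i (by simpa using hB))
    · rw [← h2]
      exact List.mem_map_of_mem (by simpa using hi)
  exact ⟨ν, hs, by rw [compositionOf, hs, h2], h1⟩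

theorem ne_zero_of_mem_compositionOf {n k : ℕ} {ν : Fin n →₀ ℕ} (hk : k ∈ compositionOf ν) :
    k ≠ 0 := by
  obtain ⟨i, hi, rfl⟩ := List.mem_map.1 hk
  simpa using hi

theorem exists_support_eq_compositionOf_eq {n : ℕ} (σ : Equiv.Perm (Fin n)) (ν : Fin n →₀ ℕ) :
    ∃ μ : Fin n →₀ ℕ, μ.support = ν.support.map σ.toEmbedding ∧
      compositionOf μ = compositionOf ν ∧
      orderedMonomial (ν.support.map σ.toEmbedding) (compositionOf ν) = monomial μ 1 :=
  exists_orderedMonomial_eq _ _ (by simp [length_compositionOf])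
    fun _ => ne_zero_of_mem_compositionOf

/-- The action of a permutation of the variables on exponents which preserves compositions. -/
noncomputable def moveExp {n : ℕ} (σ : Equiv.Perm (Fin n)) (ν : Fin n →₀ ℕ) : Fin n →₀ ℕ :=
  (exists_support_eq_compositionOf_eq σ ν).choose

theorem support_moveExp {n : ℕ} (σ : Equiv.Perm (Fin n)) (ν : Fin n →₀ ℕ) :
    (moveExp σ ν).support = ν.support.map σ.toEmbedding :=
  (exists_support_eq_compositionOf_eq σ ν).choose_spec.1

theorem compositionOf_moveExp {n : ℕ} (σ : Equiv.Perm (Fin n)) (ν : Fin n →₀ ℕ) :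
    compositionOf (moveExp σ ν) = compositionOf ν :=
  (exists_support_eq_compositionOf_eq σ ν).choose_spec.2.1

theorem orderedMonomial_map {n : ℕ} (σ : Equiv.Perm (Fin n)) (ν : Fin n →₀ ℕ) :
    orderedMonomial (ν.support.map σ.toEmbedding) (compositionOf ν) = monomial (moveExp σ ν) 1 :=
  (exists_support_eq_compositionOf_eq σ ν).choose_spec.2.2

theorem moveExp_injective {n : ℕ} (σ : Equiv.Perm (Fin n)) : Function.Injective (moveExp σ) := by
  intro μ ν h
  have h1 := congrArg Finsupp.support h
  have h2 := congrArg compositionOf h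
  rw [support_moveExp, support_moveExp] at h1
  rw [compositionOf_moveExp, compositionOf_moveExp] at h2
  exact eq_of_compositionOf_eq (Finset.map_injective _ h1) h2

theorem moveExp_symm {n : ℕ} (σ : Equiv.Perm (Fin n)) (ν : Fin n →₀ ℕ) :
    moveExp σ (moveExp σ.symm ν) = ν := by
  refine eq_of_compositionOf_eq ?_ (by rw [compositionOf_moveExp, compositionOf_moveExp])
  rw [support_moveExp, support_moveExp, Finset.map_map]
  ext
  simp

/-- The action permutes monomials through the injective map `moveExp σ` and rescales them, so
invariance can be read coefficient by coefficient. -/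
theorem coeff_moveExp_quasiAct {n : ℕ} (m : ℕ) {g : Matrix (Fin n) (Fin n) ℂ}
    {σ : Equiv.Perm (Fin n)} (hσ : ∀ i j, g i j ≠ 0 ↔ j = σ i) (P : MvPolynomial (Fin n) ℂ)
    (μ : Fin n →₀ ℕ) :
    coeff (moveExp σ μ) (quasiAct m g P) =
      coeff μ P * weight g ^ weightExponent m (compositionOf μ) := by
  induction P using MvPolynomial.induction_on' with
  | monomial ν c =>
    have hm : moveVars g ν.support = ν.support.map σ.toEmbedding := by
      ext j
      simp [moveVars, hσ, -Finset.mem_map_equiv, @eq_comm _ j]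
    have h := (basisMonomials (Fin n) ℂ).constr_basis ℂ (fun ν =>
      weight g ^ weightExponent m (compositionOf ν) •
        orderedMonomial (moveVars g ν.support) (compositionOf ν)) ν
    rw [coe_basisMonomials] at h
    have h' : monomial ν c = c • monomial ν (1 : ℂ) := by simp [smul_monomial]
    rw [h', map_smul, quasiAct, h, hm, orderedMonomial_map, smul_monomial, smul_monomial,
      smul_monomial, coeff_monomial, coeff_monomial]
    by_cases hν : ν = μ
    · simp [hν]
    · simp [hν, (moveExp_injective σ).eq_iff]
  | add p q hp hq => rw [map_add, coeff_add, coeff_add, hp, hq, add_mul]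

theorem exists_perm_of_mem {n m : ℕ} {g : Matrix (Fin n) (Fin n) ℂ} (hg : g ∈ genSymGroup n m) :
    ∃ σ : Equiv.Perm (Fin n), ∀ i j, g i j ≠ 0 ↔ j = σ i := by
  obtain ⟨h1, h2, -⟩ := hg
  choose s hs hs' using h1
  have hinj : Function.Injective s := fun i i' h =>
    (h2 (s i)).unique (hs i) (by rw [h]; exact hs i')
  refine ⟨Equiv.ofBijective s (Finite.injective_iff_bijective.1 hinj), fun i j => ?_⟩
  exact ⟨fun h => hs' i j h, fun h => by rw [h]; exact hs i⟩

/-- The monomial matrix of a permutation with given nonzero entries. -/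
def monomialMatrix {n : ℕ} (σ : Equiv.Perm (Fin n)) (u : Fin n → ℂ) : Matrix (Fin n) (Fin n) ℂ :=
  fun i j => if j = σ i then u i else 0

theorem monomialMatrix_ne_zero {n : ℕ} (σ : Equiv.Perm (Fin n)) {u : Fin n → ℂ}
    (hu : ∀ i, u i ≠ 0) (i j : Fin n) : monomialMatrix σ u i j ≠ 0 ↔ j = σ i := by
  simp [monomialMatrix, hu]

theorem monomialMatrix_mem {n m : ℕ} (hm : 0 < m) (σ : Equiv.Perm (Fin n)) {u : Fin n → ℂ}
    (hu : ∀ i, u i ^ m = 1) : monomialMatrix σ u ∈ genSymGroup n m := by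
  have hu0 : ∀ i, u i ≠ 0 := fun i h => by
    have := hu i
    rw [h, zero_pow hm.ne'] at this
    exact zero_ne_one this
  simp only [genSymGroup, Set.mem_ofPred_eq, monomialMatrix_ne_zero σ hu0]
  refine ⟨fun i => ⟨σ i, rfl, fun _ h => h⟩, fun j => ⟨σ.symm j, by simp, fun i h => by simp [h]⟩,
    fun i j h => ?_⟩
  simp [monomialMatrix, h, hu]

theorem weight_monomialMatrix {n : ℕ} (σ : Equiv.Perm (Fin n)) {u : Fin n → ℂ}
    (hu : ∀ i, u i ≠ 0) : weight (monomialMatrix σ u) = ∏ i, u i := by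
  refine Finset.prod_congr rfl fun i _ => ?_
  rw [Finset.prod_eq_single (σ i)]
  · simp [monomialMatrix, hu]
  · intro j _ hj
    simp [monomialMatrix, hj]
  · simp

theorem forall_mem_compositionOf_dvd {n m : ℕ} {ν : Fin n →₀ ℕ} :
    (∀ k ∈ compositionOf ν, m ∣ k) ↔ ∀ i, m ∣ ν i := by
  refine ⟨fun h i => ?_, fun h k hk => ?_⟩
  · by_cases hi : ν i = 0
    · simp [hi]
    · exact h _ (List.mem_map_of_mem (by simpa using hi))
  · obtain ⟨i, -, rfl⟩ := List.mem_map.1 hk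
    exact h i

theorem compositionOf_smul {n m : ℕ} (hm : 0 < m) (μ : Fin n →₀ ℕ) :
    compositionOf (m • μ) = (compositionOf μ).map (m * ·) := by
  have : (m • μ).support = μ.support := by ext; simp [hm.ne']
  rw [compositionOf, compositionOf, this, List.map_map]
  rfl

theorem compositionOf_smul_inj {n m : ℕ} (hm : 0 < m) {μ ν : Fin n →₀ ℕ} :
    compositionOf (m • μ) = compositionOf (m • ν) ↔ compositionOf μ = compositionOf ν := by
  rw [compositionOf_smul hm, compositionOf_smul hm]
  exact (List.map_injective_iff.2 fun a b h => Nat.eq_of_mul_eq_mul_left hm h).eq_iff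

theorem coeff_eq_zero_of_mem_QInv {n m : ℕ} (hm : 0 < m) {P : MvPolynomial (Fin n) ℂ}
    (hP : P ∈ QInv n m) {ν : Fin n →₀ ℕ} (hν : ¬ ∀ i, m ∣ ν i) : coeff ν P = 0 := by
  obtain ⟨i₀, hi₀⟩ := not_forall.1 hν
  have hm1 : 1 < m := by
    refine lt_of_le_of_ne hm fun h => hi₀ ?_
    rw [← h]
    exact one_dvd _
  have hζ := Complex.isPrimitiveRoot_exp m hm.ne'
  set ζ := Complex.exp (2 * Real.pi * Complex.I / m)
  -- The diagonal matrix with a single entry `ζ` fixes every monomial up to a scalar, which is `ζ ≠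
  -- 1` on `X^ν`.
  let u : Fin n → ℂ := fun i => if i = i₀ then ζ else 1
  have hu : ∀ i, u i ^ m = 1 := fun i => by
    simp only [u]
    split_ifs
    · exact hζ.pow_eq_one
    · exact one_pow m
  have hu0 : ∀ i, u i ≠ 0 := fun i => by
    simp only [u]
    split_ifs
    · exact hζ.ne_zero hm.ne'
    · exact one_ne_zero
  have h := coeff_moveExp_quasiAct m (monomialMatrix_ne_zero 1 hu0) P ν
  have h1 : moveExp 1 ν = ν :=
    eq_of_compositionOf_eq (by rw [support_moveExp]; exact Finset.map_refl) (compositionOf_moveExp _ _)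
  rw [hP _ (monomialMatrix_mem hm 1 hu), h1, weight_monomialMatrix _ hu0, weightExponent,
    if_neg (by rwa [forall_mem_compositionOf_dvd])] at h
  simp only [u, Finset.prod_ite_eq', Finset.mem_univ, if_true, pow_one] at h
  have h2 : coeff ν P * (ζ - 1) = 0 := by linear_combination -h
  exact (mul_eq_zero.1 h2).resolve_right (sub_ne_zero.2 (hζ.ne_one hm1))

theorem coeff_eq_of_mem_QInv {n m : ℕ} (hm : 0 < m) {P : MvPolynomial (Fin n) ℂ}
    (hP : P ∈ QInv n m) {ν ν' : Fin n →₀ ℕ} (hν : ∀ i, m ∣ ν i)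
    (h : compositionOf ν = compositionOf ν') : coeff ν P = coeff ν' P := by
  have hc : ν.support.card = ν'.support.card := by
    rw [← length_compositionOf, h, length_compositionOf]
  obtain ⟨σ, hσ⟩ : ∃ σ : Equiv.Perm (Fin n), ν.support.map σ.toEmbedding = ν'.support := by
    -- Any bijection between the supports will do, since the action re-sorts the variables.
    let e : {x // x ∈ ν.support} ≃ {x // x ∈ ν'.support} := Finset.equivOfCardEq hc
    refine ⟨e.extendSubtype, Finset.eq_of_subset_of_card_le ?_ (by simp [hc])⟩
    intro j hj
    obtain ⟨i, hi, rfl⟩ := Finset.mem_map.1 hj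
    exact e.extendSubtype_mem i hi
  have h1 : moveExp σ ν = ν' :=
    eq_of_compositionOf_eq (by rw [support_moveExp, hσ]) (by rw [compositionOf_moveExp, h])
  have h2 := coeff_moveExp_quasiAct m (monomialMatrix_ne_zero σ (u := 1) (by simp)) P ν
  rw [hP _ (monomialMatrix_mem hm σ (by simp)), h1, weightExponent,
    if_pos (by rwa [forall_mem_compositionOf_dvd]), pow_zero, mul_one] at h2
  exact h2.symm

theorem exists_eq_smul_of_dvd {n m : ℕ} {ν : Fin n →₀ ℕ} (hν : ∀ i, m ∣ ν i) :
    ∃ μ, ν = m • μ := by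
  choose q hq using hν
  exact ⟨Finsupp.equivFunOnFinite.symm q, by ext i; simp [← hq]⟩

theorem coeff_expand_eq_zero {n m : ℕ} (f : MvPolynomial (Fin n) ℂ) {ν : Fin n →₀ ℕ}
    (hν : ¬ ∀ i, m ∣ ν i) : coeff ν (expand m f) = 0 := by
  obtain ⟨i, hi⟩ := not_forall.1 hν
  exact coeff_expand_of_not_dvd f hi

theorem IsQuasiSymm.expand_mem_QInv {n m : ℕ} (hm : 0 < m) {f : MvPolynomial (Fin n) ℂ}
    (hf : IsQuasiSymm f) : expand m f ∈ QInv n m := by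
  intro g hg
  obtain ⟨σ, hσ⟩ := exists_perm_of_mem hg
  ext ν
  rw [← moveExp_symm σ ν]
  generalize moveExp σ.symm ν = μ
  rw [coeff_moveExp_quasiAct m hσ]
  have hc := compositionOf_moveExp σ μ
  by_cases hμ : ∀ i, m ∣ μ i
  · have hdvd : ∀ i, m ∣ moveExp σ μ i := by
      rwa [← forall_mem_compositionOf_dvd, hc, forall_mem_compositionOf_dvd]
    rw [weightExponent, if_pos (by rwa [forall_mem_compositionOf_dvd]), pow_zero, mul_one]
    obtain ⟨μ₁, h₁⟩ := exists_eq_smul_of_dvd hμ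
    obtain ⟨μ₂, h₂⟩ := exists_eq_smul_of_dvd hdvd
    rw [h₂, h₁, coeff_expand_smul _ hm.ne', coeff_expand_smul _ hm.ne']
    rw [h₂, h₁, compositionOf_smul_inj hm] at hc
    exact hf _ _ hc.symm
  · have hdvd : ¬ ∀ i, m ∣ moveExp σ μ i := by
      rwa [← forall_mem_compositionOf_dvd, hc, forall_mem_compositionOf_dvd]
    rw [coeff_expand_eq_zero f hμ, coeff_expand_eq_zero f hdvd, zero_mul]

/-! ### Residues of exponents modulo `m` -/

/-- The exponentwise quotient of `ν` by `m`. -/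
noncomputable def expQuot {n : ℕ} (m : ℕ) (ν : Fin n →₀ ℕ) : Fin n →₀ ℕ :=
  ν.mapRange (· / m) (Nat.zero_div m)

/-- The exponentwise remainder of `ν` modulo `m`. -/
noncomputable def expRem {n : ℕ} (m : ℕ) (ν : Fin n →₀ ℕ) : Fin n →₀ ℕ :=
  ν.mapRange (· % m) (Nat.zero_mod m)

theorem smul_expQuot_add_expRem {n : ℕ} (m : ℕ) (ν : Fin n →₀ ℕ) :
    m • expQuot m ν + expRem m ν = ν := by
  ext i
  simp [expQuot, expRem, Nat.div_add_mod]

theorem expRem_lt {n m : ℕ} (hm : 0 < m) (ν : Fin n →₀ ℕ) (i : Fin n) : expRem m ν i < m := by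
  simpa [expRem] using Nat.mod_lt _ hm

theorem expQuot_smul_add {n m : ℕ} (μ ν : Fin n →₀ ℕ) (hm : 0 < m) :
    expQuot m (m • μ + ν) = μ + expQuot m ν := by
  ext i
  simp [expQuot, Nat.mul_add_div hm]

theorem expRem_smul_add {n m : ℕ} (μ ν : Fin n →₀ ℕ) :
    expRem m (m • μ + ν) = expRem m ν := by
  ext i
  simp [expRem]

theorem expQuot_eq_zero {n m : ℕ} {α : Fin n →₀ ℕ} (hα : ∀ i, α i < m) : expQuot m α = 0 := by
  ext i
  simpa [expQuot] using Or.inr (hα i)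

theorem expRem_eq_self {n m : ℕ} {α : Fin n →₀ ℕ} (hα : ∀ i, α i < m) : expRem m α = α := by
  ext i
  simpa [expRem] using Nat.mod_eq_of_lt (hα i)

open Classical in
/-- The linear map extracting the terms whose exponents are congruent to `α` modulo `m`. -/
noncomputable def residuePart {n : ℕ} (m : ℕ) (α : Fin n →₀ ℕ) :
    MvPolynomial (Fin n) ℂ →ₗ[ℂ] MvPolynomial (Fin n) ℂ :=
  (basisMonomials (Fin n) ℂ).constr ℂ fun ν =>
    if expRem m ν = α then monomial (expQuot m ν) 1 else 0

open Classical in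
theorem residuePart_monomial {n : ℕ} (m : ℕ) (α ν : Fin n →₀ ℕ) (c : ℂ) :
    residuePart m α (monomial ν c) = if expRem m ν = α then monomial (expQuot m ν) c else 0 := by
  have h := (basisMonomials (Fin n) ℂ).constr_basis ℂ (fun ν =>
    if expRem m ν = α then monomial (expQuot m ν) (1 : ℂ) else 0) ν
  rw [coe_basisMonomials] at h
  have h' : monomial ν c = c • monomial ν (1 : ℂ) := by simp [smul_monomial]
  rw [h', map_smul, residuePart, h]
  split_ifs <;> simp [smul_monomial]

theorem coeff_residuePart {n m : ℕ} (hm : 0 < m) {α : Fin n →₀ ℕ} (hα : ∀ i, α i < m)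
    (f : MvPolynomial (Fin n) ℂ) (μ : Fin n →₀ ℕ) :
    coeff μ (residuePart m α f) = coeff (m • μ + α) f := by
  classical
  induction f using MvPolynomial.induction_on' with
  | monomial ν c =>
    rw [residuePart_monomial, coeff_monomial]
    by_cases h : ν = m • μ + α
    · rw [if_pos h, h, expRem_smul_add, expRem_eq_self hα, if_pos rfl, expQuot_smul_add _ _ hm,
        expQuot_eq_zero hα, add_zero, coeff_monomial, if_pos rfl]
    · rw [if_neg h]
      split_ifs with h1
      · rw [coeff_monomial, if_neg]
        rintro h2
        exact h (by rw [← h1, ← h2, smul_expQuot_add_expRem])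
      · rfl
  | add p q hp hq => rw [map_add, coeff_add, coeff_add, hp, hq]

/-- Multiplying by `expand m q` shifts exponents by multiples of `m`: residues are unchanged and
quotients add. -/
theorem residuePart_mul_expand {n m : ℕ} (hm : 0 < m) (α : Fin n →₀ ℕ)
    (p q : MvPolynomial (Fin n) ℂ) :
    residuePart m α (p * expand m q) = residuePart m α p * q := by
  classical
  induction p using MvPolynomial.induction_on' with
  | monomial ν c =>
    induction q using MvPolynomial.induction_on' with
    | monomial μ d =>
      rw [expand_monomial, monomial_mul, residuePart_monomial, residuePart_monomial,
        add_comm ν, expRem_smul_add, expQuot_smul_add _ _ hm]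
      split_ifs
      · rw [monomial_mul, add_comm μ]
      · rw [zero_mul]
    | add p q hp hq => rw [map_add, mul_add, map_add, hp, hq, mul_add]
  | add p q hp hq => rw [add_mul, map_add, map_add, hp, hq, add_mul]

/-- Diagonal matrices kill the exponents not divisible by `m`, and permutation matrices equate
coefficients with the same composition; `residuePart m 0` then recovers the preimage. -/
theorem exists_expand_eq_of_mem_QInv {n m : ℕ} (hm : 0 < m) {P : MvPolynomial (Fin n) ℂ}
    (hP : P ∈ QInv n m) : ∃ f, IsQuasiSymm f ∧ expand m f = P := by
  have hc : ∀ μ, coeff μ (residuePart m 0 P) = coeff (m • μ) P := fun μ => by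
    rw [coeff_residuePart hm (fun _ => hm), add_zero]
  refine ⟨residuePart m 0 P, fun μ μ' h => ?_, ?_⟩
  · rw [hc, hc]
    exact coeff_eq_of_mem_QInv hm hP (by simp) ((compositionOf_smul_inj hm).2 h)
  · ext ν
    by_cases hν : ∀ i, m ∣ ν i
    · obtain ⟨μ, rfl⟩ := exists_eq_smul_of_dvd hν
      rw [coeff_expand_smul _ hm.ne', hc]
    · rw [coeff_expand_eq_zero _ hν, coeff_eq_zero_of_mem_QInv hm hP hν]

/-! ### Transfer between `quasiIdeal` and the ideal of quasi-invariants. -/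

theorem expand_mem_span {n m : ℕ} (hm : 0 < m) {f : MvPolynomial (Fin n) ℂ}
    (hf : f ∈ quasiIdeal n) : expand m f ∈ Ideal.span (QInvPlus n m) := by
  have : quasiIdeal n ≤ (Ideal.span (QInvPlus n m)).comap (expand m) :=
    Ideal.span_le.2 fun q hq => Ideal.subset_span ⟨hq.1.expand_mem_QInv hm, by
      rw [constantCoeff_eq, coeff_expand_zero _ hm.ne']; exact hq.2⟩
  exact this hf

theorem residuePart_mem {n m : ℕ} (hm : 0 < m) (α : Fin n →₀ ℕ) {f : MvPolynomial (Fin n) ℂ}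
    (hf : f ∈ Ideal.span (QInvPlus n m)) : residuePart m α f ∈ quasiIdeal n := by
  -- `residuePart` does not commute with arbitrary multipliers, so the multiplier is built into the
  -- induction.
  suffices h : ∀ p, residuePart m α (p * f) ∈ quasiIdeal n by simpa using h 1
  induction hf using Submodule.span_induction with
  | mem q hq =>
    intro p
    obtain ⟨f, hf, rfl⟩ := exists_expand_eq_of_mem_QInv hm hq.1
    rw [residuePart_mul_expand hm]
    refine Ideal.mul_mem_left _ _ (Ideal.subset_span ⟨hf, ?_⟩)
    have := hq.2
    rwa [constantCoeff_eq, coeff_expand_zero _ hm.ne'] at this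
  | zero => simp
  | add a b _ _ ha hb =>
    intro p
    rw [mul_add, map_add]
    exact add_mem (ha p) (hb p)
  | smul a b _ hb =>
    intro p
    rw [smul_eq_mul, ← mul_assoc]
    exact hb _

theorem exists_of_mem_span_dyckMonomials {n m : ℕ} {f : MvPolynomial (Fin n) ℂ}
    (hf : f ∈ Submodule.span ℂ (dyckMonomials n m)) {ν : Fin n →₀ ℕ} (hν : coeff ν f ≠ 0) :
    ∃ η α : Fin n →₀ ℕ, IsDyck η ∧ (∀ i, α i < m) ∧ ν = m • η + α := by
  classical
  induction hf using Submodule.span_induction with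
  | mem q hq =>
    obtain ⟨η, α, hη, hα, rfl⟩ := hq
    rw [coeff_monomial] at hν
    exact ⟨η, α, hη, hα, by by_contra h; exact hν (if_neg (Ne.symm h))⟩
  | zero => exact absurd rfl hν
  | add a b _ _ ha hb =>
    by_cases h : coeff ν a = 0
    · exact hb (by simpa [h] using hν)
    · exact ha h
  | smul c a _ ha => exact ha fun h => hν (by simp [h])

/-- Each residue component of `f` lies in `quasiIdeal` and has Dyck exponents only, because quotient
and remainder by `m` recover `η` and `α`. -/
theorem disjoint_span_dyckMonomials {n m : ℕ} (hm : 0 < m) {f : MvPolynomial (Fin n) ℂ}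
    (hd : f ∈ Submodule.span ℂ (dyckMonomials n m)) (hf : f ∈ Ideal.span (QInvPlus n m)) :
    f = 0 := by
  ext ν
  have hα := expRem_lt hm ν
  have h0 : residuePart m (expRem m ν) f = 0 := by
    refine eq_zero_of_mem_of_isDyck (residuePart_mem hm _ hf) fun μ hμ => ?_
    rw [coeff_residuePart hm hα] at hμ
    obtain ⟨η, β, hη, hβ, h⟩ := exists_of_mem_span_dyckMonomials hd hμ
    have h' := congrArg (expQuot m) h
    rw [expQuot_smul_add _ _ hm, expQuot_smul_add _ _ hm, expQuot_eq_zero hα,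
      expQuot_eq_zero hβ, add_zero, add_zero] at h'
    rwa [h']
  have h1 := coeff_residuePart hm hα f (expQuot m ν)
  rw [h0, smul_expQuot_add_expRem] at h1
  exact h1.symm

theorem monomial_mem_sup_span {n m : ℕ} (hm : 0 < m) (ν : Fin n →₀ ℕ) :
    monomial ν (1 : ℂ) ∈ Submodule.span ℂ (dyckMonomials n m) ⊔
      (Ideal.span (QInvPlus n m)).restrictScalars ℂ := by
  have hα := expRem_lt hm ν
  -- The map `q ↦ X^α * expand m q`, with `α` the remainder of `ν`, carries the decomposition for `m
  -- = 1` to the one for `m`.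
  have key : dyckSpan n ⊔ (quasiIdeal n).restrictScalars ℂ ≤
      (Submodule.span ℂ (dyckMonomials n m) ⊔
        (Ideal.span (QInvPlus n m)).restrictScalars ℂ).comap
        ((LinearMap.mulLeft ℂ (monomial (expRem m ν) 1)).comp (expand m).toLinearMap) := by
    refine sup_le (Submodule.span_le.2 ?_) fun q hq => ?_
    · rintro _ ⟨η, hη, rfl⟩
      refine Submodule.mem_sup_left (Submodule.subset_span ⟨η, expRem m ν, hη, hα, ?_⟩)
      simp [monomial_mul, add_comm]
    · exact Submodule.mem_sup_right (Ideal.mul_mem_left _ _ (expand_mem_span hm hq))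
  have := key (monomial_mem_sup (expQuot m ν))
  rw [Submodule.mem_comap] at this
  simpa [monomial_mul, add_comm (expRem m ν), smul_expQuot_add_expRem] using this

theorem linearIndependent_dyckMonomials (n m : ℕ) :
    LinearIndependent ℂ (Subtype.val : dyckMonomials n m → MvPolynomial (Fin n) ℂ) := by
  have h := (basisMonomials (Fin n) ℂ).linearIndependent.linearIndepOn_id
  refine h.mono ?_
  rintro _ ⟨η, α, -, -, rfl⟩
  exact ⟨m • η + α, by rw [coe_basisMonomials]⟩

end QuasiInv

/-! ### Assembly of the basis of the quotient. -/

theorem mainTheorem2 (n m : ℕ) (hm : 0 < m) :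
    ∃ b : Module.Basis (QuasiInv.dyckMonomials n m) ℂ
        (MvPolynomial (Fin n) ℂ ⧸ Ideal.span (QuasiInv.QInvPlus n m)),
      ∀ p : QuasiInv.dyckMonomials n m,
        b p = Ideal.Quotient.mk (Ideal.span (QuasiInv.QInvPlus n m))
          (p : MvPolynomial (Fin n) ℂ) := by
  let π := (Ideal.Quotient.mkₐ ℂ (Ideal.span (QuasiInv.QInvPlus n m))).toLinearMap
  have hli : LinearIndependent ℂ
      (π ∘ (Subtype.val : QuasiInv.dyckMonomials n m → MvPolynomial (Fin n) ℂ)) := by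
    refine (QuasiInv.linearIndependent_dyckMonomials n m).map ?_
    rw [Submodule.disjoint_def, Subtype.range_coe]
    exact fun f hf hf' =>
      QuasiInv.disjoint_span_dyckMonomials hm hf (Ideal.Quotient.eq_zero_iff_mem.1 hf')
  have hsp : ⊤ ≤ Submodule.span ℂ (Set.range
      (π ∘ (Subtype.val : QuasiInv.dyckMonomials n m → MvPolynomial (Fin n) ℂ))) := by
    rw [Set.range_comp, Subtype.range_coe, Submodule.span_image]
    rintro x -
    obtain ⟨f, rfl⟩ := Ideal.Quotient.mk_surjective x
    have hf : f ∈ Submodule.span ℂ (QuasiInv.dyckMonomials n m) ⊔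
        (Ideal.span (QuasiInv.QInvPlus n m)).restrictScalars ℂ := by
      rw [f.as_sum]
      refine Submodule.sum_mem _ fun ν _ => ?_
      rw [← mul_one (MvPolynomial.coeff ν f), ← smul_eq_mul, ← MvPolynomial.smul_monomial]
      exact Submodule.smul_mem _ _ (QuasiInv.monomial_mem_sup_span hm ν)
    obtain ⟨a, ha, c, hc, rfl⟩ := Submodule.mem_sup.1 hf
    refine ⟨a, ha, ?_⟩
    rw [map_add, Ideal.Quotient.eq_zero_iff_mem.2 hc, add_zero]
    rfl
  exact ⟨Module.Basis.mk hli hsp, fun p => Module.Basis.mk_apply hli hsp p⟩
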